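/- A \emph{surface} is a Hausdorff space each of whose points has a neighborhood homeomorphic to $\mathbb{R}\times\mathbb{R}_{\ge 0}$ (neither connectedness nor metrisability is assumed). Its boundary $\partial S$ is the set of points that have no neighborhood homeomorphic to $\mathbb{R}^2$. A closed subset $B$ of a space $X$ is \emph{collared} in $X$ if there is a topological embedding $h:B\times[0,1]\to X$ such that $h(x,0)=x$ for all $x\in B$, $h^{-1}(B)=B\times\{0\}$ and $h(B\times[0,1))$ is open in $X$; it is \emph{strongly collared} if $h$ can moreover be chosen to be a closed embedding. A \emph{zero-set} of $X$ is a set of the form $f^{-1}(\{0\})$ with $f:X\to\mathbb{R}$ continuous. Let $\mathbb{P}$ be the half plane Pr\"uferised at each height: as a set, $\mathbb{P}$ is the disjoint union of $(0,\infty)\times\mathbb{R}$ and of a copy $\mathbb{R}_a$ of $\mathbb{R}$ for each $a\in\mathbb{R}$. Its topology has as a basis the usual open subsets of $(0,\infty)\times\mathbb{R}$ and, for $a,u,v,w\in\mathbb{R}$ with $u<v$ and $w>0$, the unions of the interval $(u,v)\subset\mathbb{R}_a$ and the wedge $\{\langle s,y\rangle : 0<s<w,\ a+us<y<a+vs\}$.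 For $D\subset\mathbb{R}$, let $\mathbb{P}_D$ be the quotient space of $\mathbb{P}$ obtained by \emph{Moorising} at the heights in $D$, that is, by identifying $x$ with $-x$ in $\mathbb{R}_a$ for each $a\in D$; the image of $\mathbb{R}_a$ in $\mathbb{P}_D$ is still denoted by $\mathbb{R}_a$. (1) $\mathbb{P}$ is a surface with boundary $\bigcup_{a\in\mathbb{R}}\mathbb{R}_a$. Let $G\subset\mathbb{R}$ be non-meagre and let $U\subset\mathbb{P}$ be an open set such that $U\cap\mathbb{R}_a\neq\varnothing$ for each $a\in G$. Then there are $c,u,v\in\mathbb{R}$ with $c>0$ and $u<v$ such that $U$ contains the strip $(0,c)\times(u,v)$. (2) The second assertion of (1) also holds with $\mathbb{P}_D$ in place of $\mathbb{P}$, for every $D\subset\mathbb{R}$. (3) Let $S=\mathbb{P}_{\mathbb{R}\setminus\mathbb{Q}}$. Then $S$ is a separable surface with boundary $\partial S=\bigcup_{a\in\mathbb{Q}}\mathbb{R}_a$, and $\partial S$ is metrisable and collared in $S$, but $\partial S$ is not a zero-set in $S$ and is not strongly collared in $S$. -/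

import Mathlib

open Set Topology

/-- A surface: a Hausdorff space in which every point has a neighborhood (not necessarily open)
homeomorphic to the closed half plane `ℝ × [0, ∞)`. Neither connectedness nor metrisability is
required. -/
def IsSurface (X : Type*) [TopologicalSpace X] : Prop :=
  T2Space X ∧ ∀ p : X, ∃ N ∈ 𝓝 p, Nonempty (N ≃ₜ ℝ × Ici (0 : ℝ))

/-- The boundary of a surface: the points without a neighborhood homeomorphic to the plane. -/
def surfaceBoundary (X : Type*) [TopologicalSpace X] : Set X :=
  {p | ¬ ∃ N ∈ 𝓝 p, Nonempty (N ≃ₜ ℝ × ℝ)}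

/-- `B` is a zero-set: the inverse image of `{0}` under a continuous real-valued function. -/
def IsZeroSet {X : Type*} [TopologicalSpace X] (B : Set X) : Prop :=
  ∃ f : X → ℝ, Continuous f ∧ f ⁻¹' {0} = B

/-- `h : B × [0,1] → X` satisfies the requirements on a collar of `B` in `X`, apart from being an
embedding: it is the identity on `B × {0}`, only `B × {0}` is sent into `B`, and the image of
`B × [0,1)` is open. -/
def IsCollarMap {X : Type*} [TopologicalSpace X] (B : Set X) (h : B × unitInterval → X) : Prop :=
  (∀ x : B, h (x, 0) = x) ∧ h ⁻¹' B = {z | z.2 = 0} ∧ IsOpen (h '' {z | z.2 < 1})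

/-- The closed set `B` is collared in `X`. -/
def IsCollared {X : Type*} [TopologicalSpace X] (B : Set X) : Prop :=
  IsClosed B ∧ ∃ h : B × unitInterval → X, IsEmbedding h ∧ IsCollarMap B h

/-- The closed set `B` is strongly collared in `X`: it has a collar that is a closed embedding. -/
def IsStronglyCollared {X : Type*} [TopologicalSpace X] (B : Set X) : Prop :=
  IsClosed B ∧ ∃ h : B × unitInterval → X, IsClosedEmbedding h ∧ IsCollarMap B h

/-- The points of the half plane Prüferised at each height: the points of the open half plane
`(0, ∞) × ℝ` and, in place of each point `⟨0, a⟩` of the vertical axis, a copy `ℝ_a` of `ℝ`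
whose points are `edge a x`. -/
inductive Prufer : Type
  | plane (p : {p : ℝ × ℝ // 0 < p.1}) : Prufer
  | edge (a x : ℝ) : Prufer

namespace Prufer

/-- The interval `(u, v)` of `ℝ_a` together with the open wedge between the lines of slopes `u` and
`v` through `⟨0, a⟩` and to the left of the vertical line at abscissa `w`. -/
def wedge (a u v w : ℝ) : Set Prufer :=
  edge a '' Ioo u v ∪
    plane '' {p | p.1.1 < w ∧ a + u * p.1.1 < p.1.2 ∧ p.1.2 < a + v * p.1.1}

/-- The topology with basis the usual open subsets of the open half plane and the wedges. -/
instance : TopologicalSpace Prufer :=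
  TopologicalSpace.generateFrom
    ({O | ∃ V : Set {p : ℝ × ℝ // 0 < p.1}, IsOpen V ∧ O = plane '' V} ∪
      {O | ∃ a u v w : ℝ, 0 < w ∧ O = wedge a u v w})

/-- The added component `ℝ_a`. -/
def component (a : ℝ) : Set Prufer := range (edge a)

/-- The strip `(0, c) × (u, v)` along the boundary. -/
def strip (c u v : ℝ) : Set Prufer :=
  plane '' {p | p.1.1 < c ∧ u < p.1.2 ∧ p.1.2 < v}

/-- For every height `a ∈ D`, identify `x` with `-x` in `ℝ_a`. -/
def mooreSetoid (D : Set ℝ) : Setoid Prufer where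
  r p q := p = q ∨ ∃ a ∈ D, ∃ x : ℝ, p = edge a x ∧ q = edge a (-x)
  iseqv := by
    refine ⟨fun p => Or.inl rfl, ?_, ?_⟩
    · rintro p q (rfl | ⟨a, ha, x, rfl, rfl⟩)
      · exact Or.inl rfl
      · exact Or.inr ⟨a, ha, -x, rfl, by rw [neg_neg]⟩
    · rintro p q r (rfl | ⟨a, ha, x, rfl, rfl⟩) h
      · exact h
      · rcases h with rfl | ⟨b, hb, y, h1, rfl⟩
        · exact Or.inr ⟨a, ha, x, rfl, rfl⟩
        · obtain ⟨rfl, rfl⟩ := edge.inj h1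
          exact Or.inl (by rw [neg_neg])

end Prufer

/-- The half plane Prüferised at each height and Moorised at the heights in `D`, with the quotient
topology. -/
def MoorePrufer (D : Set ℝ) : Type := Quotient (Prufer.mooreSetoid D)

namespace MoorePrufer

instance (D : Set ℝ) : TopologicalSpace (MoorePrufer D) :=
  inferInstanceAs (TopologicalSpace (Quotient (Prufer.mooreSetoid D)))

/-- The identification map. -/
def proj (D : Set ℝ) (p : Prufer) : MoorePrufer D := Quotient.mk (Prufer.mooreSetoid D) p

/-- The image of `ℝ_a` (folded at `0` if `a ∈ D`). -/
def component (D : Set ℝ) (a : ℝ) : Set (MoorePrufer D) := proj D '' Prufer.component a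

/-- The strip `(0, c) × (u, v)` along the boundary. -/
def strip (D : Set ℝ) (c u v : ℝ) : Set (MoorePrufer D) := proj D '' Prufer.strip c u v

end MoorePrufer

/-! Slope and abscissa are coordinates around `ℝ_a` in which wedges become boxes, so `chart a`
embeds a closed half plane openly in `ℙ`. Moorising at `a` folds the edge of this half plane;
squaring in `ℂ` performs the same fold, so the points of `ℝ_a` become interior
(`exists_planar_chart`). If `a` is not Moorised, the chart survives, and its edge points are
boundary points because a loop in a punctured half disc has no winding number
(`not_planar_of_halfPlane_chart`).

The strip property is a category argument. An open set meeting `ℝ_a` contains a wedge at `a` with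
rational slopes and width. There are countably many such triples, so one of them serves a set of
heights that is dense in some interval. Parallel wedges over a dense set of apexes sweep out a
strip. Pulling back along `proj D` extends this to `ℙ_D`.

In the surface Moorised at the irrationals, the Ford discs at the rationals are pairwise disjoint.
They provide disjoint open half-open collars of the lines `ℝ_q`, so the boundary is a sum of
countably many lines, and is collared (`isOpenEmbedding_fordCollar`). A continuous function
vanishing exactly on the boundary would be bounded away from `0` on some point of `ℝ_a` for
non-meagrely many irrational `a`, hence on a strip; but a rational height in that strip forces
values near `0`. A strong collar would produce such a function, namely its height
(`IsStronglyCollared.isZeroSet`). -/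

/-! ### Topological invariance of the boundary of the half plane -/

/-- The closed half plane. -/
abbrev HalfPlane : Type := ℝ × Ici (0 : ℝ)

/-- The boundary points of the closed half plane. -/
def halfEdge (t : ℝ) : HalfPlane := (t, ⟨0, mem_Ici.2 le_rfl⟩)

/-- The point of the closed half plane at distance `r` from `(t, 0)` and at angle `θ` from the
vertical, folded into the half plane. -/
noncomputable def halfPolar (t r θ : ℝ) : HalfPlane :=
  (t + r * Real.sin θ, ⟨|r * Real.cos θ|, mem_Ici.2 (abs_nonneg _)⟩)

theorem continuous_halfPolar (t : ℝ) {Y : Type*} [TopologicalSpace Y] {r θ : Y → ℝ}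
    (hr : Continuous r) (hθ : Continuous θ) : Continuous fun y => halfPolar t (r y) (θ y) := by
  unfold halfPolar
  refine Continuous.prodMk (by fun_prop) (Continuous.subtype_mk (by fun_prop) _)

theorem dist_halfPolar_le (t r θ : ℝ) : dist (halfPolar t r θ) (halfEdge t) ≤ |r| := by
  rw [Prod.dist_eq]
  refine max_le ?_ ?_
  · simp only [halfPolar, halfEdge, Real.dist_eq, add_sub_cancel_left, abs_mul]
    exact mul_le_of_le_one_right (abs_nonneg _) (Real.abs_sin_le_one _)
  · simp only [halfPolar, Subtype.dist_eq, Real.dist_eq, halfEdge, sub_zero, abs_abs, abs_mul]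
    exact mul_le_of_le_one_right (abs_nonneg _) (Real.abs_cos_le_one _)

theorem halfPolar_ne (t : ℝ) {r : ℝ} (hr : r ≠ 0) (θ : ℝ) : halfPolar t r θ ≠ (halfEdge t) := by
  intro h
  have h1 := congrArg Prod.fst h
  have h2 := congrArg (fun z => (z.2 : ℝ)) h
  simp only [halfPolar, halfEdge, add_eq_left, mul_eq_zero, hr, false_or] at h1
  simp only [halfPolar, halfEdge, abs_eq_zero, mul_eq_zero, hr, false_or] at h2
  have := Real.sin_sq_add_cos_sq θ
  simp [h1, h2] at this

theorem halfPolar_norm_arg (t : ℝ) (z : HalfPlane) :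
    halfPolar t ‖(⟨z.2, z.1 - t⟩ : ℂ)‖ (Complex.arg ⟨z.2, z.1 - t⟩) = z := by
  refine Prod.ext ?_ (Subtype.ext ?_)
  · simp only [halfPolar, Complex.norm_mul_sin_arg]; ring
  · simp only [halfPolar, Complex.norm_mul_cos_arg]; exact abs_of_nonneg (mem_Ici.1 z.2.2)

/-- A boundary point of a half plane chart has no neighborhood homeomorphic to the plane. -/
theorem not_planar_of_halfPlane_chart {X : Type*} [TopologicalSpace X] {e : HalfPlane → X}
    (he : IsOpenEmbedding e) (t : ℝ) : ¬ ∃ N ∈ 𝓝 (e (halfEdge t)), Nonempty (N ≃ₜ ℝ × ℝ) := by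
  rintro ⟨N, hN, ⟨φ₀⟩⟩
  let φ : N ≃ₜ ℂ := φ₀.trans Complex.equivRealProdCLM.symm.toHomeomorph
  obtain ⟨ε, hε, hball⟩ := Metric.mem_nhds_iff.1 (he.continuous.continuousAt.preimage_mem_nhds hN)
  -- Logarithmic polar coordinates, defined on all of `ℂ` thanks to the absolute value in
  -- `halfPolar`. The radius is truncated at `ε / 2` so that the point stays in the preimage of `N`.
  let R : ℂ → ℝ := fun ζ => Real.exp (min ζ.re (Real.log (ε / 2)))
  have hRpos : ∀ ζ, 0 < R ζ := fun ζ => Real.exp_pos _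
  have hRle : ∀ ζ, R ζ ≤ ε / 2 := fun ζ => by
    rw [← Real.exp_log (half_pos hε)]
    exact Real.exp_le_exp.2 (min_le_right _ _)
  have hRc : Continuous R := by fun_prop
  have hmem : ∀ ζ : ℂ, e (halfPolar t (R ζ) ζ.im) ∈ N := fun ζ => hball <| by
    have := dist_halfPolar_le t (R ζ) ζ.im
    rw [abs_of_pos (hRpos ζ)] at this
    rw [Metric.mem_ball]
    linarith [hRle ζ]
  let c : ℂ := φ ⟨e (halfEdge t), mem_of_mem_nhds hN⟩
  let g : C(ℂ, ℂ) := ⟨fun ζ => φ ⟨e (halfPolar t (R ζ) ζ.im), hmem ζ⟩ - c, by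
    refine Continuous.sub (φ.continuous.comp (Continuous.subtype_mk ?_ _)) continuous_const
    exact he.continuous.comp (continuous_halfPolar t hRc Complex.continuous_im)⟩
  have hg : ∀ ζ, g ζ ∈ ({0}ᶜ : Set ℂ) := fun ζ h => by
    have h1 : φ ⟨e (halfPolar t (R ζ) ζ.im), hmem ζ⟩ = φ ⟨e (halfEdge t), mem_of_mem_nhds hN⟩ :=
      sub_eq_zero.1 h
    exact halfPolar_ne t (hRpos ζ).ne' _ (he.injective (congrArg Subtype.val (φ.injective h1)))
  -- `g` avoids `0` on the simply connected plane, hence has a continuous logarithm `F`.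
  obtain ⟨F, ⟨-, hF⟩, -⟩ := Complex.isCoveringMapOn_exp.existsUnique_continuousMap_lifts g
    (a₀ := 0) (e₀ := Complex.log (g 0)) (Complex.exp_log (hg 0)) hg
  have hV : IsOpen (φ '' (Subtype.val ⁻¹' (e '' Metric.ball (halfEdge t) (ε / 4)))) :=
    φ.isOpenMap _ ((he.isOpenMap _ Metric.isOpen_ball).preimage continuous_subtype_val)
  have hcV : c ∈ φ '' (Subtype.val ⁻¹' (e '' Metric.ball (halfEdge t) (ε / 4))) :=
    ⟨_, ⟨(halfEdge t), Metric.mem_ball_self (by positivity), rfl⟩, rfl⟩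
  obtain ⟨δ, hδ, hδV⟩ := Metric.isOpen_iff.1 hV c hcV
  let ρ : ℝ := δ / 2
  have hρ : 0 < ρ := half_pos hδ
  -- A small circle around `c` is pulled back to a loop `σ` in the half disc. The radius `ε / 4` in
  -- the sup metric bounds `‖w‖` by `ε / 2`, where the truncation in `R` is inactive.
  let γ : ℝ → N := fun θ => φ.symm (c + ρ * Complex.exp (θ * Complex.I))
  have hγ : Continuous γ := by fun_prop
  have hσ : ∀ θ, ∃ z ∈ Metric.ball (halfEdge t) (ε / 4), e z = γ θ := fun θ => by
    have : c + ρ * Complex.exp (θ * Complex.I) ∈ Metric.ball c δ := by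
      rw [Metric.mem_ball, dist_self_add_left, norm_mul, Complex.norm_exp_ofReal_mul_I, mul_one,
        Complex.norm_real, Real.norm_of_nonneg hρ.le]
      exact half_lt_self hδ
    obtain ⟨n, ⟨z, hz, hzn⟩, hn⟩ := hδV this
    refine ⟨z, hz, ?_⟩
    simp only [γ, ← hn, Homeomorph.symm_apply_apply, hzn]
  choose σ hσball hσe using hσ
  have hσc : Continuous σ := by
    rw [he.isInducing.continuous_iff]
    have : e ∘ σ = Subtype.val ∘ γ := funext hσe
    rw [this]
    exact continuous_subtype_val.comp hγ
  let w : ℝ → ℂ := fun θ => ⟨(σ θ).2, (σ θ).1 - t⟩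
  have hσne : ∀ θ, σ θ ≠ (halfEdge t) := fun θ h => by
    have h1 : γ θ = ⟨e (halfEdge t), mem_of_mem_nhds hN⟩ := Subtype.ext (by rw [← hσe, h])
    have h2 : φ (γ θ) = c := congrArg φ h1
    simp [γ, hρ.ne'] at h2
  have hw0 : ∀ θ, w θ ≠ 0 := fun θ h => hσne θ <| by
    have h1 := congrArg Complex.re h
    have h2 := congrArg Complex.im h
    exact Prod.ext (sub_eq_zero.1 h2) (Subtype.ext h1)
  -- `w` stays in the closed right half plane without `0`, so the principal logarithm is continuous
  -- along the loop.
  have hwslit : ∀ θ, w θ ∈ Complex.slitPlane := fun θ => by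
    rw [Complex.mem_slitPlane_iff]
    by_contra! h
    exact hw0 θ (Complex.ext (le_antisymm h.1 (σ θ).2.2) h.2)
  have hwc : Continuous w := by
    have : w = fun θ => ((σ θ).2 : ℂ) + ((σ θ).1 - t : ℝ) * Complex.I := by
      funext θ; apply Complex.ext <;> simp [w]
    rw [this]
    fun_prop
  have hLc : Continuous fun θ => Complex.log (w θ) := hwc.clog hwslit
  have hwle : ∀ θ, ‖w θ‖ ≤ ε / 2 := fun θ => by
    have h1 := (Prod.dist_eq (x := σ θ) (y := (halfEdge t))).symm.trans_lt (hσball θ)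
    rw [max_lt_iff, Real.dist_eq, Subtype.dist_eq, Real.dist_eq] at h1
    have h2 := Complex.norm_le_abs_re_add_abs_im (w θ)
    simp only [w, halfEdge, sub_zero] at h1 h2 ⊢
    linarith [h1.1, h1.2]
  have hpt : ∀ θ, halfPolar t (R (Complex.log (w θ))) (Complex.log (w θ)).im = σ θ := fun θ => by
    have : R (Complex.log (w θ)) = ‖w θ‖ := by
      simp only [R, Complex.log_re]
      rw [min_eq_left (Real.log_le_log (norm_pos_iff.2 (hw0 θ)) (hwle θ)),
        Real.exp_log (norm_pos_iff.2 (hw0 θ))]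
    rw [this, Complex.log_im]
    exact halfPolar_norm_arg t (σ θ)
  have hexp : ∀ θ : ℝ, Complex.exp (F (Complex.log (w θ))) = ρ * Complex.exp (θ * Complex.I) :=
    fun θ => by
    have h1 : Complex.exp (F (Complex.log (w θ))) = g (Complex.log (w θ)) := congrFun hF _
    have h2 : (⟨e (halfPolar t (R (Complex.log (w θ))) (Complex.log (w θ)).im), hmem _⟩ : N)
        = γ θ := Subtype.ext ((congrArg e (hpt θ)).trans (hσe θ))
    rw [h1]
    change φ _ - c = _
    rw [h2]
    simp [γ]
  -- Both sides lift the circle through `exp` and agree at `0`. The right side grows by `2πi` over a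
  -- period, whereas the left side returns to its initial value with `σ`.
  have key : (fun θ : ℝ => F (Complex.log (w θ))) =
      fun θ : ℝ => F (Complex.log (w 0)) + θ * Complex.I := by
    refine Complex.isCoveringMap_exp.eq_of_comp_eq (F.continuous.comp hLc) (by fun_prop)
      ?_ 0 (by simp)
    funext θ
    refine Subtype.ext ?_
    simp only [Function.comp_apply, hexp, Complex.exp_add]
    simp
  have hper : σ (2 * Real.pi) = σ 0 := he.injective <| by
    rw [hσe, hσe]
    simp [γ]
  have h2pi := congrFun key (2 * Real.pi)
  have hw2 : w (2 * Real.pi) = w 0 := by simp only [w, hper]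
  simp [hw2, Real.pi_ne_zero] at h2pi

/-! ### Charts of the Prüfer surface -/

namespace Prufer

theorem plane_injective : Function.Injective plane := fun _ _ h => plane.inj h

theorem isOpen_image_plane {V : Set {p : ℝ × ℝ // 0 < p.1}} (hV : IsOpen V) :
    IsOpen (plane '' V) :=
  TopologicalSpace.isOpen_generateFrom_of_mem (Or.inl ⟨V, hV, rfl⟩)

theorem isOpen_wedge (a u v : ℝ) {w : ℝ} (hw : 0 < w) : IsOpen (wedge a u v w) :=
  TopologicalSpace.isOpen_generateFrom_of_mem (Or.inr ⟨a, u, v, w, hw, rfl⟩)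

@[simp]
theorem edge_mem_wedge {a u v w b x : ℝ} : edge b x ∈ wedge a u v w ↔ b = a ∧ u < x ∧ x < v := by
  simp only [wedge, mem_union, mem_image, mem_Ioo, edge.injEq, reduceCtorEq, and_false,
    exists_false, or_false]
  constructor
  · rintro ⟨y, hy, rfl, rfl⟩
    exact ⟨rfl, hy⟩
  · rintro ⟨rfl, h⟩
    exact ⟨x, h, rfl, rfl⟩

@[simp]
theorem plane_mem_wedge {a u v w : ℝ} {p : {p : ℝ × ℝ // 0 < p.1}} :
    plane p ∈ wedge a u v w ↔ p.1.1 < w ∧ a + u * p.1.1 < p.1.2 ∧ p.1.2 < a + v * p.1.1 := by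
  simp [wedge]

/-- The chart around the component `ℝ_a`: the coordinates are the slope and the abscissa. -/
noncomputable def chart (a : ℝ) (z : HalfPlane) : Prufer :=
  if h : 0 < (z.2 : ℝ) then plane ⟨(z.2, a + z.1 * z.2), h⟩ else edge a z.1

theorem chart_of_pos (a : ℝ) {z : HalfPlane} (h : 0 < (z.2 : ℝ)) :
    chart a z = plane ⟨(z.2, a + z.1 * z.2), h⟩ := dif_pos h

@[simp]
theorem chart_halfEdge (a t : ℝ) : chart a (halfEdge t) = edge a t := dif_neg (lt_irrefl _)

theorem _root_.HalfPlane.eq_halfEdge_or_pos (z : HalfPlane) :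
    z = halfEdge z.1 ∨ 0 < (z.2 : ℝ) := by
  rcases (mem_Ici.1 z.2.2).eq_or_lt with h | h
  · exact Or.inl (Prod.ext rfl (Subtype.ext h.symm))
  · exact Or.inr h

/-- The coordinates of a point of the open half plane in the chart around `ℝ_a`. -/
noncomputable def coord (a : ℝ) (p : {p : ℝ × ℝ // 0 < p.1}) : HalfPlane :=
  ((p.1.2 - a) / p.1.1, ⟨p.1.1, mem_Ici.2 p.2.le⟩)

theorem continuous_coord (a : ℝ) : Continuous (coord a) := by
  unfold coord
  refine Continuous.prodMk (Continuous.div (by fun_prop) (by fun_prop) fun p => p.2.ne') ?_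
  exact Continuous.subtype_mk (by fun_prop) _

theorem chart_coord (a : ℝ) (p : {p : ℝ × ℝ // 0 < p.1}) : chart a (coord a p) = plane p := by
  rw [chart_of_pos a (z := coord a p) p.2]
  have := p.2.ne'
  congr 1
  refine Subtype.ext (Prod.ext rfl ?_)
  simp only [coord]
  field_simp
  ring

theorem chart_injective (a : ℝ) : Function.Injective (chart a) := by
  intro z z' h
  rcases z.eq_halfEdge_or_pos with hz | hz <;> rcases z'.eq_halfEdge_or_pos with hz' | hz'
  · rw [hz, hz', chart_halfEdge, chart_halfEdge] at h
    rw [hz, hz', (edge.inj h).2]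
  · rw [hz, chart_halfEdge, chart_of_pos a hz'] at h
    cases h
  · rw [hz', chart_halfEdge, chart_of_pos a hz] at h
    cases h
  · rw [chart_of_pos a hz, chart_of_pos a hz'] at h
    have h1 := congrArg Subtype.val (plane.inj h)
    have h2 : (z.2 : ℝ) = z'.2 := congrArg Prod.fst h1
    have h3 : a + z.1 * z.2 = a + z'.1 * z'.2 := congrArg Prod.snd h1
    rw [h2] at h3
    exact Prod.ext (mul_right_cancel₀ hz'.ne' (add_left_cancel h3)) (Subtype.ext h2)

theorem continuous_chart (a : ℝ) : Continuous (chart a) := by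
  refine continuous_generateFrom_iff.2 ?_
  rintro _ (⟨V, hV, rfl⟩ | ⟨b, u, v, w, hw, rfl⟩)
  · obtain ⟨W, hW, rfl⟩ := isOpen_induced_iff.1 hV
    have : chart a ⁻¹' (plane '' (Subtype.val ⁻¹' W)) =
        {z : HalfPlane | 0 < (z.2 : ℝ)} ∩ (fun z => ((z.2 : ℝ), a + z.1 * z.2)) ⁻¹' W := by
      ext z
      rcases z.eq_halfEdge_or_pos with hz | hz
      · rw [hz]; simp [halfEdge, chart]
      · simp [chart_of_pos a hz, hz]
    rw [this]
    exact (isOpen_lt continuous_const (by fun_prop)).inter (hW.preimage (by fun_prop))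
  -- The first set gives the points of positive abscissa. The second is needed only for `a = b`:
  -- dividing by the abscissa turns the wedge into a box that also contains the edge points.
  · have : chart a ⁻¹' wedge b u v w =
        {z : HalfPlane | 0 < (z.2 : ℝ) ∧ (z.2 : ℝ) < w ∧ b + u * z.2 < a + z.1 * z.2 ∧
          a + z.1 * z.2 < b + v * z.2} ∪
        {z : HalfPlane | a = b ∧ (z.2 : ℝ) < w ∧ u < z.1 ∧ z.1 < v} := by
      ext z
      rcases z.eq_halfEdge_or_pos with hz | hz
      · rw [hz]
        simp [halfEdge, chart, hw]
      · simp only [mem_preimage, chart_of_pos a hz, plane_mem_wedge, mem_union, mem_ofPred_eq, hz,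
          true_and]
        refine ⟨Or.inl, ?_⟩
        rintro (h | ⟨rfl, h1, h2, h3⟩)
        · exact h
        · exact ⟨h1, by gcongr, by gcongr⟩
    rw [this]
    refine IsOpen.union ?_ ?_
    · exact (isOpen_lt (by fun_prop) (by fun_prop)).and ((isOpen_lt (by fun_prop) (by fun_prop)).and
        ((isOpen_lt (by fun_prop) (by fun_prop)).and (isOpen_lt (by fun_prop) (by fun_prop))))
    · exact isOpen_const.and ((isOpen_lt (by fun_prop) (by fun_prop)).and
        ((isOpen_lt (by fun_prop) (by fun_prop)).and (isOpen_lt (by fun_prop) (by fun_prop))))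

/-- A neighborhood of a boundary point of the half plane contains a box. -/
theorem _root_.HalfPlane.exists_box {V : Set HalfPlane} {t : ℝ} (hV : V ∈ 𝓝 (halfEdge t)) :
    ∃ ε > 0, ∀ z : HalfPlane, t - ε < z.1 → z.1 < t + ε → (z.2 : ℝ) < ε → z ∈ V := by
  obtain ⟨ε, hε, h⟩ := Metric.mem_nhds_iff.1 hV
  refine ⟨ε, hε, fun z h1 h2 h3 => h ?_⟩
  rw [Metric.mem_ball, Prod.dist_eq, max_lt_iff, Subtype.dist_eq, Real.dist_eq, Real.dist_eq,
    abs_lt, abs_lt]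
  have := mem_Ici.1 z.2.2
  simp only [halfEdge]
  refine ⟨⟨?_, ?_⟩, ?_, ?_⟩ <;> linarith

/-- In slope and abscissa coordinates a wedge is a box, so boxes in the half plane correspond to
basic neighborhoods of edge points. -/
theorem wedge_subset_image_chart {a u v w : ℝ} {V : Set HalfPlane}
    (h : ∀ z : HalfPlane, u < z.1 → z.1 < v → (z.2 : ℝ) < w → z ∈ V) (hw : 0 < w) :
    wedge a u v w ⊆ chart a '' V := by
  rintro (p | ⟨b, x⟩) hp
  · rw [plane_mem_wedge] at hp
    refine ⟨coord a p, h _ ?_ ?_ hp.1, chart_coord a p⟩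
    · rw [coord, lt_div_iff₀ p.2]; linarith
    · rw [coord, div_lt_iff₀ p.2]; linarith
  · rw [edge_mem_wedge] at hp
    obtain ⟨rfl, h1, h2⟩ := hp
    exact ⟨halfEdge x, h _ h1 h2 hw, chart_halfEdge _ _⟩

theorem isOpenMap_chart (a : ℝ) : IsOpenMap (chart a) := by
  intro V hV
  refine isOpen_iff_forall_mem_open.2 ?_
  rintro _ ⟨z, hz, rfl⟩
  rcases z.eq_halfEdge_or_pos with h | h
  · rw [h] at hz ⊢
    obtain ⟨ε, hε, hε'⟩ := HalfPlane.exists_box (hV.mem_nhds hz)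
    exact ⟨_, wedge_subset_image_chart hε' hε, isOpen_wedge _ _ _ hε, by simp [hε]⟩
  · refine ⟨plane '' (coord a ⁻¹' V), ?_, isOpen_image_plane (hV.preimage (continuous_coord a)), ?_⟩
    · rintro _ ⟨p, hp, rfl⟩
      exact ⟨_, hp, chart_coord a p⟩
    · have h1 := chart_coord a ⟨(z.2, a + z.1 * z.2), h⟩
      rw [← chart_of_pos a h] at h1
      refine ⟨⟨(z.2, a + z.1 * z.2), h⟩, ?_, (chart_of_pos a h).symm⟩
      rw [mem_preimage, chart_injective a h1]
      exact hz

theorem isOpenEmbedding_chart (a : ℝ) : IsOpenEmbedding (chart a) :=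
  .of_continuous_injective_isOpenMap (continuous_chart a) (chart_injective a) (isOpenMap_chart a)

theorem mem_range_chart {a : ℝ} {p : Prufer} :
    p ∈ range (chart a) ↔ p ∈ range plane ∨ p ∈ component a := by
  constructor
  · rintro ⟨z, rfl⟩
    rcases z.eq_halfEdge_or_pos with h | h
    · rw [h, chart_halfEdge]
      exact Or.inr ⟨_, rfl⟩
    · rw [chart_of_pos a h]
      exact Or.inl ⟨_, rfl⟩
  · rintro (⟨p, rfl⟩ | ⟨x, rfl⟩)
    · exact ⟨_, chart_coord a p⟩
    · exact ⟨_, chart_halfEdge a x⟩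

theorem isOpenEmbedding_plane : IsOpenEmbedding plane := by
  refine .of_continuous_injective_isOpenMap ?_ plane_injective fun V hV => isOpen_image_plane hV
  have : plane = chart 0 ∘ coord 0 := funext fun p => (chart_coord 0 p).symm
  rw [this]
  exact (continuous_chart 0).comp (continuous_coord 0)

/-! ### The strip property -/

/-- An open set that meets all components over a non-meagre set of heights contains a strip. -/
theorem exists_strip_subset {G : Set ℝ} (hG : ¬ IsMeagre G) {U : Set Prufer} (hU : IsOpen U)
    (h : ∀ a ∈ G, (component a ∩ U).Nonempty) :
    ∃ c u v : ℝ, 0 < c ∧ u < v ∧ strip c u v ⊆ U := by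
  -- Rational parameters leave only countably many wedge shapes.
  have hw : ∀ a ∈ G, ∃ i : ℚ × ℚ × ℚ, (i.1 : ℝ) < i.2.1 ∧ (0 : ℝ) < i.2.2 ∧
      wedge a i.1 i.2.1 i.2.2 ⊆ U := by
    intro a ha
    obtain ⟨_, ⟨x, rfl⟩, hx⟩ := h a ha
    rw [← chart_halfEdge] at hx
    obtain ⟨ε, hε, hε'⟩ := HalfPlane.exists_box
      ((hU.preimage (continuous_chart a)).mem_nhds hx)
    obtain ⟨q, hq1, hq2⟩ := exists_rat_btwn (sub_lt_self x hε)
    obtain ⟨r, hr1, hr2⟩ := exists_rat_btwn (lt_add_of_pos_right x hε)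
    obtain ⟨w, hw1, hw2⟩ := exists_rat_btwn hε
    refine ⟨(q, r, w), hq2.trans hr1, hw1, ?_⟩
    refine (wedge_subset_image_chart (V := chart a ⁻¹' U) ?_ hw1).trans (image_preimage_subset _ _)
    exact fun z h1 h2 h3 => hε' z (hq1.trans h1) (h2.trans hr2) (h3.trans hw2)
  have hcov : ∃ i : ℚ × ℚ × ℚ, ¬ IsMeagre {a | (i.1 : ℝ) < i.2.1 ∧ (0 : ℝ) < i.2.2 ∧
      wedge a i.1 i.2.1 i.2.2 ⊆ U} := by
    by_contra! hcon
    refine hG ((isMeagre_iUnion hcon).mono fun a ha => ?_)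
    exact mem_iUnion.2 (hw a ha)
  obtain ⟨⟨u, v, w⟩, hi⟩ := hcov
  have huv : (u : ℝ) < v ∧ (0 : ℝ) < w := by
    obtain ⟨a, ha⟩ := nonempty_of_not_isMeagre hi
    exact ⟨ha.1, ha.2.1⟩
  obtain ⟨huv, hw0⟩ := huv
  have hint : (interior (closure {a : ℝ | wedge a u v w ⊆ U})).Nonempty := by
    rw [nonempty_iff_ne_empty]
    intro hcon
    have hnd : IsNowhereDense {a : ℝ | wedge a u v w ⊆ U} := hcon
    exact hi (hnd.isMeagre.mono fun a ha => ha.2.2)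
  obtain ⟨m, hm⟩ := hint
  obtain ⟨ε, hε, hball⟩ := Metric.isOpen_iff.1 isOpen_interior m hm
  -- The width makes `|u * s|` and `|v * s|` smaller than `ε / 2`; the other half of `ε` is spent on
  -- `|y - m|`.
  have hK : 0 < |(u : ℝ)| + |(v : ℝ)| + 1 := by positivity
  refine ⟨min w (ε / 2 / (|(u : ℝ)| + |(v : ℝ)| + 1)), m - ε / 2, m + ε / 2, by positivity,
    by linarith, ?_⟩
  rintro _ ⟨⟨⟨s, y⟩, hs⟩, ⟨h1, h2, h3⟩, rfl⟩
  simp only at hs h1 h2 h3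
  rw [lt_min_iff, lt_div_iff₀ hK] at h1
  have hus : |u * s| ≤ s * (|(u : ℝ)| + |(v : ℝ)| + 1) := by
    rw [abs_mul, abs_of_pos hs, mul_comm]
    gcongr
    linarith [abs_nonneg (v : ℝ)]
  have hvs : |v * s| ≤ s * (|(u : ℝ)| + |(v : ℝ)| + 1) := by
    rw [abs_mul, abs_of_pos hs, mul_comm]
    gcongr
    linarith [abs_nonneg (u : ℝ)]
  have huvs : u * s < v * s := by gcongr
  rw [abs_le] at hus hvs
  -- The wedge at `a` contains `(s, y)` when `y - v * s < a < y - u * s`. This interval meets the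
  -- ball around `m`, in which the admissible heights are dense.
  have hlt : max (y - v * s) (m - ε) < min (y - u * s) (m + ε) := by
    rw [max_lt_iff, lt_min_iff, lt_min_iff]
    refine ⟨⟨?_, ?_⟩, ?_, ?_⟩ <;> linarith [h1.2]
  obtain ⟨b, hb⟩ := nonempty_Ioo.2 hlt
  have hbc : b ∈ closure {a : ℝ | wedge a u v w ⊆ U} := by
    refine interior_subset (hball ?_)
    rw [Real.ball_eq_Ioo]
    exact ⟨(le_max_right _ _).trans_lt hb.1, hb.2.trans_le (min_le_right _ _)⟩
  obtain ⟨a, ha, haU⟩ := mem_closure_iff.1 hbc _ isOpen_Ioo hb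
  refine haU (plane_mem_wedge.2 ⟨h1.1, ?_, ?_⟩)
  · simp only
    linarith [ha.2.trans_le (min_le_left _ _)]
  · simp only
    linarith [(le_max_left _ _).trans_lt ha.1]

end Prufer

/-! ### Planar neighborhoods and the folded half plane -/

/-- A homeomorphism between the plane and the open half plane. -/
theorem exists_homeomorph_openHalfPlane : Nonempty ({p : ℝ × ℝ // 0 < p.1} ≃ₜ ℝ × ℝ) :=
  ⟨{ toFun := fun p => (Real.log p.1.1, p.1.2)
     invFun := fun z => ⟨(Real.exp z.1, z.2), Real.exp_pos _⟩
     left_inv := fun p => Subtype.ext (Prod.ext (Real.exp_log p.2) rfl)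
     right_inv := fun z => Prod.ext (Real.log_exp z.1) rfl
     continuous_toFun := by
       refine Continuous.prodMk (Continuous.log (by fun_prop) fun p => p.2.ne') (by fun_prop)
     continuous_invFun := Continuous.subtype_mk (by fun_prop) _ }⟩

theorem exists_planar_nhds_of_openEmbedding {X Y : Type*} [TopologicalSpace X] [TopologicalSpace Y]
    (φ : Y ≃ₜ ℝ × ℝ) {e : Y → X} (he : IsOpenEmbedding e) (y : Y) :
    ∃ N ∈ 𝓝 (e y), Nonempty (N ≃ₜ ℝ × ℝ) :=
  ⟨range e, he.isOpen_range.mem_nhds ⟨y, rfl⟩, ⟨he.isEmbedding.toHomeomorph.symm.trans φ⟩⟩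

/-- A point with a planar neighborhood has a neighborhood that is a closed half plane. -/
theorem exists_halfPlane_nhds {X : Type*} [TopologicalSpace X] {p : X}
    (h : ∃ N ∈ 𝓝 p, Nonempty (N ≃ₜ ℝ × ℝ)) : ∃ N ∈ 𝓝 p, Nonempty (N ≃ₜ ℝ × Ici (0 : ℝ)) := by
  obtain ⟨N, hN, ⟨φ⟩⟩ := h
  let q : N := ⟨p, mem_of_mem_nhds hN⟩
  -- The half plane is placed so that `p` lies at height `1` above its edge.
  let j : ℝ × Ici (0 : ℝ) → X := fun z => φ.symm (z.1, (φ q).2 - 1 + z.2)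
  have hpre : {z : ℝ × ℝ | (φ q).2 - 1 < z.2} ∈ 𝓝 (φ q) :=
    (isOpen_lt continuous_const continuous_snd).mem_nhds (by simp)
  have hj : IsEmbedding j := by
    refine IsEmbedding.subtypeVal.comp (φ.symm.isEmbedding.comp ?_)
    have h1 : IsEmbedding fun z : ℝ × Ici (0 : ℝ) => (z.1, (z.2 : ℝ)) :=
      IsEmbedding.id.prodMap IsEmbedding.subtypeVal
    exact ((Homeomorph.refl ℝ).prodCongr (Homeomorph.addLeft ((φ q).2 - 1))).isEmbedding.comp h1
  refine ⟨range j, ?_, ⟨hj.toHomeomorph.symm⟩⟩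
  have h2 : φ ⁻¹' {z : ℝ × ℝ | (φ q).2 - 1 < z.2} ∈ 𝓝 q :=
    φ.continuous.continuousAt.preimage_mem_nhds hpre
  rw [mem_nhds_subtype_iff_nhdsWithin, nhdsWithin_eq_nhds.2 hN] at h2
  refine Filter.mem_of_superset h2 ?_
  rintro _ ⟨n, hn, rfl⟩
  have hn' : (φ q).2 - 1 < (φ n).2 := hn
  refine ⟨((φ n).1, ⟨(φ n).2 - ((φ q).2 - 1), mem_Ici.2 (by linarith)⟩), ?_⟩
  simp [j]

/-- The map that folds the boundary of the half plane at `0`. -/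
noncomputable def squareMap (z : HalfPlane) : ℂ := (⟨z.1, z.2⟩ : ℂ) ^ 2

/-- A continuous closed surjection is a quotient map. Squaring is closed as a polynomial map, and of
two opposite square roots one lies in the closed upper half plane. -/
theorem isQuotientMap_squareMap : IsQuotientMap squareMap := by
  have hemb : IsClosedEmbedding fun z : HalfPlane => (⟨z.1, z.2⟩ : ℂ) :=
    Complex.equivRealProdCLM.symm.toHomeomorph.isClosedEmbedding.comp
      (IsClosedEmbedding.id.prodMap isClosed_Ici.isClosedEmbedding_subtypeVal)
  have hsq : IsClosedMap fun z : ℂ => z ^ 2 := by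
    have h : (fun z : ℂ => z ^ 2) = fun z => (Polynomial.X ^ 2 : Polynomial ℂ).eval z := by
      funext z
      simp
    rw [h]
    exact Polynomial.isClosedMap_eval _
  refine (hsq.comp hemb.isClosedMap).isQuotientMap ((continuous_pow 2).comp hemb.continuous) ?_
  intro w
  obtain ⟨z, rfl⟩ := IsAlgClosed.exists_pow_nat_eq w two_pos
  rcases le_total 0 z.im with h | h
  · exact ⟨(z.re, ⟨z.im, h⟩), rfl⟩
  · refine ⟨(-z.re, ⟨-z.im, mem_Ici.2 (by linarith)⟩), ?_⟩
    have : (⟨-z.re, -z.im⟩ : ℂ) = -z := rfl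
    simp only [Function.comp_apply, this, neg_sq]

theorem squareMap_eq_iff {z z' : HalfPlane} :
    squareMap z = squareMap z' ↔
      z = z' ∨ ∃ t : ℝ, z = halfEdge t ∧ z' = halfEdge (-t) := by
  constructor
  · intro h
    rcases sq_eq_sq_iff_eq_or_eq_neg.1 h with h | h
    · rw [Complex.ext_iff] at h
      exact Or.inl (Prod.ext h.1 (Subtype.ext h.2))
    · rw [Complex.ext_iff] at h
      have h1 : z.1 = -z'.1 := h.1
      have h2 : (z.2 : ℝ) = -z'.2 := h.2
      have h3 := mem_Ici.1 z.2.2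
      have h4 := mem_Ici.1 z'.2.2
      refine Or.inr ⟨z.1, Prod.ext rfl (Subtype.ext ?_), Prod.ext ?_ (Subtype.ext ?_)⟩
      · simp only [halfEdge]; linarith
      · simp only [halfEdge]; linarith
      · simp only [halfEdge]; linarith
  · rintro (rfl | ⟨t, rfl, rfl⟩)
    · rfl
    · simp only [squareMap, halfEdge]
      apply Complex.ext <;> simp [pow_two]

/-! ### Charts, separation and boundary of the Moorised surface -/

namespace MoorePrufer

open Prufer

variable {D : Set ℝ}

theorem isQuotientMap_proj (D : Set ℝ) : IsQuotientMap (proj D) := isQuotientMap_quot_mk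

theorem continuous_proj (D : Set ℝ) : Continuous (proj D) := (isQuotientMap_proj D).continuous

theorem proj_surjective (D : Set ℝ) : Function.Surjective (proj D) :=
  (isQuotientMap_proj D).surjective

theorem proj_eq_iff {p q : Prufer} :
    proj D p = proj D q ↔ p = q ∨ ∃ a ∈ D, ∃ x : ℝ, p = edge a x ∧ q = edge a (-x) :=
  Quotient.eq (r := mooreSetoid D)

theorem preimage_image_proj {W : Set Prufer} (hW : ∀ a ∈ D, ∀ x, edge a x ∈ W → edge a (-x) ∈ W) :
    proj D ⁻¹' (proj D '' W) = W := by
  refine Subset.antisymm ?_ (subset_preimage_image _ _)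
  rintro q ⟨p, hp, hpq⟩
  rcases proj_eq_iff.1 hpq with rfl | ⟨a, ha, x, rfl, rfl⟩
  · exact hp
  · exact hW a ha x hp

theorem isOpen_image_proj {W : Set Prufer} (hO : IsOpen W)
    (hW : ∀ a ∈ D, ∀ x, edge a x ∈ W → edge a (-x) ∈ W) : IsOpen (proj D '' W) := by
  rw [← (isQuotientMap_proj D).isOpen_preimage, preimage_image_proj hW]
  exact hO

theorem isOpenEmbedding_plane (D : Set ℝ) : IsOpenEmbedding (proj D ∘ plane) := by
  refine .of_continuous_injective_isOpenMap
    ((continuous_proj D).comp Prufer.isOpenEmbedding_plane.continuous) ?_ ?_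
  · intro p q h
    rcases proj_eq_iff.1 h with h | ⟨a, -, x, h, -⟩
    · exact plane_injective h
    · cases h
  · intro V hV
    rw [image_comp]
    refine isOpen_image_proj (isOpen_image_plane hV) ?_
    rintro a - x ⟨p, -, h⟩
    cases h

theorem edge_mem_image_chart {a b x : ℝ} {V : Set HalfPlane} :
    edge b x ∈ chart a '' V ↔ b = a ∧ halfEdge x ∈ V := by
  constructor
  · rintro ⟨z, hz, h⟩
    rcases z.eq_halfEdge_or_pos with h' | h'
    · rw [h', chart_halfEdge] at h
      obtain ⟨rfl, h1⟩ := edge.inj h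
      rw [h', h1] at hz
      exact ⟨rfl, hz⟩
    · rw [chart_of_pos a h'] at h
      cases h
  · rintro ⟨rfl, h⟩
    exact ⟨_, h, chart_halfEdge _ _⟩

theorem isOpenEmbedding_chart {a : ℝ} (ha : a ∉ D) : IsOpenEmbedding (proj D ∘ chart a) := by
  refine .of_continuous_injective_isOpenMap
    ((continuous_proj D).comp (continuous_chart a)) ?_ ?_
  · intro z z' h
    rcases proj_eq_iff.1 h with h | ⟨b, hb, x, h, -⟩
    · exact chart_injective a h
    · have : edge b x ∈ chart a '' univ := ⟨z, mem_univ _, h⟩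
      exact absurd ((edge_mem_image_chart.1 this).1 ▸ hb) ha
  · intro V hV
    rw [image_comp]
    refine isOpen_image_proj (isOpenMap_chart a V hV) fun b hb x hx => ?_
    exact absurd ((edge_mem_image_chart.1 hx).1 ▸ hb) ha

/-- The fibers of `squareMap` are exactly the identifications made in `ℝ_a`, so the chart descends
along this quotient map to `ℂ`. -/
theorem exists_planar_chart {a : ℝ} (ha : a ∈ D) :
    ∃ g : ℂ → MoorePrufer D, IsOpenEmbedding g ∧ g ∘ squareMap = proj D ∘ chart a := by
  have hker : ∀ z z', proj D (chart a z) = proj D (chart a z') ↔ squareMap z = squareMap z' := by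
    intro z z'
    rw [squareMap_eq_iff, proj_eq_iff]
    refine or_congr (chart_injective a).eq_iff ⟨?_, ?_⟩
    · rintro ⟨b, -, x, h1, h2⟩
      have h3 : edge b x ∈ chart a '' {z} := ⟨z, rfl, h1⟩
      have h4 : edge b (-x) ∈ chart a '' {z'} := ⟨z', rfl, h2⟩
      exact ⟨x, (edge_mem_image_chart.1 h3).2.symm, (edge_mem_image_chart.1 h4).2.symm⟩
    · rintro ⟨t, rfl, rfl⟩
      exact ⟨a, ha, t, chart_halfEdge _ _, chart_halfEdge _ _⟩
  have hq := isQuotientMap_squareMap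
  let g : ℂ → MoorePrufer D := fun w => proj D (chart a (Function.surjInv hq.surjective w))
  have hg : g ∘ squareMap = proj D ∘ chart a := funext fun z =>
    (hker _ _).2 (Function.surjInv_eq hq.surjective (squareMap z))
  refine ⟨g, .of_continuous_injective_isOpenMap ?_ ?_ ?_, hg⟩
  · rw [hq.continuous_iff, hg]
    exact (continuous_proj D).comp (continuous_chart a)
  · intro w w' h
    have := (hker _ _).1 h
    rwa [Function.surjInv_eq hq.surjective, Function.surjInv_eq hq.surjective] at this
  · intro V hV
    have : g '' V = proj D '' (chart a '' (squareMap ⁻¹' V)) := by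
      rw [← image_comp, ← hg, image_comp, image_preimage_eq _ hq.surjective]
    rw [this]
    refine isOpen_image_proj (isOpenMap_chart a _ (hV.preimage hq.continuous)) fun b _ x hx => ?_
    rw [edge_mem_image_chart] at hx ⊢
    refine ⟨hx.1, ?_⟩
    have h1 : squareMap (halfEdge x) = squareMap (halfEdge (-x)) :=
      squareMap_eq_iff.2 (Or.inr ⟨x, rfl, rfl⟩)
    rw [mem_preimage, ← h1]
    exact hx.2

theorem exists_t2_openEmbedding (D : Set ℝ) (a : ℝ) : ∃ (Y : Type) (_ : TopologicalSpace Y)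
    (_ : T2Space Y) (g : Y → MoorePrufer D), IsOpenEmbedding g ∧
      range (proj D ∘ chart a) ⊆ range g := by
  by_cases ha : a ∈ D
  · obtain ⟨g, hg, h⟩ := exists_planar_chart ha
    exact ⟨ℂ, _, inferInstance, g, hg, h ▸ range_comp_subset_range _ _⟩
  · exact ⟨HalfPlane, _, inferInstance, _, isOpenEmbedding_chart ha, Subset.rfl⟩

theorem separated_of_mem_range_chart {a : ℝ} {p q : Prufer} (hp : p ∈ range (chart a))
    (hq : q ∈ range (chart a)) (hpq : proj D p ≠ proj D q) :
    ∃ U V : Set (MoorePrufer D), IsOpen U ∧ IsOpen V ∧ proj D p ∈ U ∧ proj D q ∈ V ∧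
      Disjoint U V := by
  obtain ⟨Y, _, _, g, hg, h⟩ := exists_t2_openEmbedding D a
  obtain ⟨z, rfl⟩ := hp
  obtain ⟨z', rfl⟩ := hq
  obtain ⟨y, hy⟩ := h ⟨z, rfl⟩
  obtain ⟨y', hy'⟩ := h ⟨z', rfl⟩
  obtain ⟨U, V, hU, hV, hyU, hyV, hUV⟩ := t2_separation fun h : y = y' => hpq (by
    change (proj D ∘ chart a) z = (proj D ∘ chart a) z'
    rw [← hy, ← hy', h])
  refine ⟨g '' U, g '' V, hg.isOpenMap U hU, hg.isOpenMap V hV, ?_, ?_,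
    (disjoint_image_iff hg.injective).2 hUV⟩
  · exact ⟨y, hyU, hy⟩
  · exact ⟨y', hyV, hy'⟩

theorem isOpen_image_symmetric_wedge (D : Set ℝ) (a u : ℝ) {w : ℝ} (hw : 0 < w) :
    IsOpen (proj D '' wedge a (-u) u w) := by
  refine isOpen_image_proj (isOpen_wedge _ _ _ hw) fun b _ x hx => ?_
  rw [edge_mem_wedge] at hx ⊢
  refine ⟨hx.1, ?_, ?_⟩ <;> linarith [hx.2.1, hx.2.2]

/-- At abscissa below `w` each wedge stays within `u * w ≤ |a - b| / 2` of its apex height. -/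
theorem disjoint_image_symmetric_wedge (D : Set ℝ) {a b u w : ℝ} (hab : a ≠ b) (hu : 0 < u)
    (hw : 2 * u * w ≤ |a - b|) :
    Disjoint (proj D '' wedge a (-u) u w) (proj D '' wedge b (-u) u w) := by
  rw [disjoint_left]
  rintro _ ⟨p, hp, rfl⟩ ⟨q, hq, hpq⟩
  rcases proj_eq_iff.1 hpq with rfl | ⟨c, hc, x, rfl, rfl⟩
  · rcases q with p | ⟨c, x⟩
    · rw [plane_mem_wedge] at hp hq
      have : u * p.1.1 < u * w := by gcongr; exact hp.1
      rcases abs_cases (a - b) with h | h <;>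
        nlinarith [hp.2.1, hp.2.2, hq.2.1, hq.2.2]
    · rw [edge_mem_wedge] at hp hq
      exact hab (hp.1.symm.trans hq.1)
  · rw [edge_mem_wedge] at hp hq
    exact hab (hp.1.symm.trans hq.1)

/-- Two points in the range of one chart are separated there. Only points over different heights
remain; thin wedges separate them, and symmetric slopes make these saturated for every `D`. -/
instance (D : Set ℝ) : T2Space (MoorePrufer D) := by
  refine ⟨fun x y hxy => ?_⟩
  obtain ⟨p, rfl⟩ := proj_surjective D x
  obtain ⟨q, rfl⟩ := proj_surjective D y
  rcases p with p | ⟨a, s⟩ <;> rcases q with q | ⟨b, t⟩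
  · exact separated_of_mem_range_chart (a := 0) (mem_range_chart.2 (Or.inl ⟨_, rfl⟩))
      (mem_range_chart.2 (Or.inl ⟨_, rfl⟩)) hxy
  · exact separated_of_mem_range_chart (a := b) (mem_range_chart.2 (Or.inl ⟨_, rfl⟩))
      (mem_range_chart.2 (Or.inr ⟨_, rfl⟩)) hxy
  · exact separated_of_mem_range_chart (a := a) (mem_range_chart.2 (Or.inr ⟨_, rfl⟩))
      (mem_range_chart.2 (Or.inl ⟨_, rfl⟩)) hxy
  · rcases eq_or_ne a b with rfl | hab
    · exact separated_of_mem_range_chart (a := a) (mem_range_chart.2 (Or.inr ⟨_, rfl⟩))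
        (mem_range_chart.2 (Or.inr ⟨_, rfl⟩)) hxy
    · have hu : 0 < |s| + |t| + 1 := by positivity
      have hd : 0 < |a - b| := abs_pos.2 (sub_ne_zero.2 hab)
      have hw : 0 < |a - b| / (2 * (|s| + |t| + 1)) := by positivity
      refine ⟨_, _, isOpen_image_symmetric_wedge D a (|s| + |t| + 1) hw,
        isOpen_image_symmetric_wedge D b (|s| + |t| + 1) hw,
        mem_image_of_mem _ (edge_mem_wedge.2 ⟨rfl, ?_, ?_⟩),
        mem_image_of_mem _ (edge_mem_wedge.2 ⟨rfl, ?_, ?_⟩),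
        disjoint_image_symmetric_wedge D hab hu (mul_div_cancel₀ _ (by positivity)).le⟩
      · linarith [neg_abs_le s, abs_nonneg t]
      · linarith [le_abs_self s, abs_nonneg t]
      · linarith [neg_abs_le t, abs_nonneg s]
      · linarith [le_abs_self t, abs_nonneg s]

theorem exists_planar_nhds_plane (D : Set ℝ) (p : {p : ℝ × ℝ // 0 < p.1}) :
    ∃ N ∈ 𝓝 (proj D (plane p)), Nonempty (N ≃ₜ ℝ × ℝ) := by
  obtain ⟨φ⟩ := exists_homeomorph_openHalfPlane
  exact exists_planar_nhds_of_openEmbedding φ (isOpenEmbedding_plane D) p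

theorem exists_planar_nhds_edge {a : ℝ} (ha : a ∈ D) (x : ℝ) :
    ∃ N ∈ 𝓝 (proj D (edge a x)), Nonempty (N ≃ₜ ℝ × ℝ) := by
  obtain ⟨g, hg, h⟩ := exists_planar_chart ha
  have h1 : g (squareMap (halfEdge x)) = proj D (edge a x) :=
    (congrFun h (halfEdge x)).trans (congrArg _ (chart_halfEdge a x))
  rw [← h1]
  exact exists_planar_nhds_of_openEmbedding Complex.equivRealProdCLM.toHomeomorph hg _

theorem isSurface (D : Set ℝ) : IsSurface (MoorePrufer D) := by
  refine ⟨inferInstance, fun x => ?_⟩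
  obtain ⟨p | ⟨a, x⟩, rfl⟩ := proj_surjective D x
  · exact exists_halfPlane_nhds (exists_planar_nhds_plane D p)
  · by_cases ha : a ∈ D
    · exact exists_halfPlane_nhds (exists_planar_nhds_edge ha x)
    · have he := isOpenEmbedding_chart ha
      refine ⟨_, he.isOpen_range.mem_nhds ⟨halfEdge x, ?_⟩, ⟨he.isEmbedding.toHomeomorph.symm⟩⟩
      rw [Function.comp_apply, chart_halfEdge]

theorem edge_mem_surfaceBoundary {a : ℝ} (ha : a ∉ D) (x : ℝ) :
    proj D (edge a x) ∈ surfaceBoundary (MoorePrufer D) := by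
  have := not_planar_of_halfPlane_chart (isOpenEmbedding_chart ha) x
  rwa [Function.comp_apply, chart_halfEdge] at this

theorem mem_surfaceBoundary_iff {y : MoorePrufer D} :
    y ∈ surfaceBoundary (MoorePrufer D) ↔ ∃ a ∉ D, ∃ x, y = proj D (edge a x) := by
  constructor
  · intro h
    obtain ⟨p | ⟨a, x⟩, rfl⟩ := proj_surjective D y
    · exact absurd (exists_planar_nhds_plane D p) h
    · exact ⟨a, fun ha => h (exists_planar_nhds_edge ha x), x, rfl⟩
  · rintro ⟨a, ha, x, rfl⟩
    exact edge_mem_surfaceBoundary ha x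

theorem isClosed_surfaceBoundary {X : Type*} [TopologicalSpace X] :
    IsClosed (surfaceBoundary X) := by
  rw [← isOpen_compl_iff, isOpen_iff_forall_mem_open]
  intro p hp
  obtain ⟨N, hN, hφ⟩ := not_not.1 hp
  exact ⟨interior N, fun q hq => not_not.2 ⟨N, mem_interior_iff_mem_nhds.1 hq, hφ⟩,
    isOpen_interior, mem_interior_iff_mem_nhds.2 hN⟩

/-- An open set that meets all components over a non-meagre set of heights contains a strip. -/
theorem exists_strip_subset {G : Set ℝ} (hG : ¬ IsMeagre G) {U : Set (MoorePrufer D)}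
    (hU : IsOpen U) (h : ∀ a ∈ G, (component D a ∩ U).Nonempty) :
    ∃ c u v : ℝ, 0 < c ∧ u < v ∧ strip D c u v ⊆ U := by
  obtain ⟨c, u, v, hc, huv, hs⟩ := Prufer.exists_strip_subset hG (hU.preimage (continuous_proj D))
    fun a ha => by
      obtain ⟨_, ⟨p, hp, rfl⟩, hpU⟩ := h a ha
      exact ⟨p, hp, hpU⟩
  exact ⟨c, u, v, hc, huv, image_subset_iff.2 hs⟩

end MoorePrufer

/-! ### The Prüfer surface and its boundary -/

theorem Prufer.isSurface : IsSurface Prufer := by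
  refine ⟨?_, ?_⟩
  -- With nothing to identify, `proj ∅` is injective, so separation is inherited.
  · refine T2Space.of_injective_continuous (f := MoorePrufer.proj ∅) (fun p q h => ?_)
      (MoorePrufer.continuous_proj ∅)
    simpa using MoorePrufer.proj_eq_iff.1 h
  · rintro (p | ⟨a, x⟩)
    · obtain ⟨φ⟩ := exists_homeomorph_openHalfPlane
      exact exists_halfPlane_nhds
        (exists_planar_nhds_of_openEmbedding φ Prufer.isOpenEmbedding_plane p)
    · have he := Prufer.isOpenEmbedding_chart a
      exact ⟨_, he.isOpen_range.mem_nhds ⟨halfEdge x, Prufer.chart_halfEdge a x⟩,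
        ⟨he.isEmbedding.toHomeomorph.symm⟩⟩

theorem Prufer.surfaceBoundary_eq :
    surfaceBoundary Prufer = ⋃ a : ℝ, Prufer.component a := by
  ext p
  rw [mem_iUnion]
  constructor
  · intro h
    rcases p with p | ⟨a, x⟩
    · obtain ⟨φ⟩ := exists_homeomorph_openHalfPlane
      exact absurd (exists_planar_nhds_of_openEmbedding φ Prufer.isOpenEmbedding_plane p) h
    · exact ⟨a, x, rfl⟩
  · rintro ⟨a, x, rfl⟩
    have := not_planar_of_halfPlane_chart (Prufer.isOpenEmbedding_chart a) x
    rwa [Prufer.chart_halfEdge] at this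

/-! ### Strong collars and zero-sets -/

/-- A strong collar gives rise to a continuous function: its height, extended by `1`. -/
theorem IsStronglyCollared.isZeroSet {X : Type*} [TopologicalSpace X] {B : Set X}
    (hB : IsStronglyCollared B) : IsZeroSet B := by
  obtain ⟨-, h, hemb, hid, hpre, hopen⟩ := hB
  let f : X → ℝ := Function.extend h (fun z => (z.2 : ℝ)) fun _ => 1
  have hfh : ∀ z, f (h z) = z.2 := fun z => hemb.injective.extend_apply _ _ z
  have hf1 : ∀ x, x ∉ range h → f x = 1 := fun x hx => Function.extend_apply' _ _ _ hx
  have hlt : ∀ z, h z ∈ h '' {z | z.2 < 1} ↔ z.2 < 1 := fun z => hemb.injective.mem_set_image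
  refine ⟨f, continuous_iff_isClosed.2 fun C hC => ?_, ?_⟩
  · have h1 : f ⁻¹' C = h '' ((fun z => (z.2 : ℝ)) ⁻¹' C) ∪
        {x | (1 : ℝ) ∈ C ∧ x ∈ (h '' {z | z.2 < 1})ᶜ} := by
      ext x
      by_cases hx : x ∈ range h
      · obtain ⟨z, rfl⟩ := hx
        rw [mem_preimage, hfh, mem_union, hemb.injective.mem_set_image, mem_preimage,
          mem_ofPred_eq, mem_compl_iff, hlt, not_lt]
        refine ⟨Or.inl, ?_⟩
        rintro (h | ⟨h, h'⟩)
        · exact h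
        · rwa [le_antisymm z.2.2.2 h']
      · have hx' : ∀ V, x ∉ h '' V := fun V hV => hx (image_subset_range _ _ hV)
        rw [mem_preimage, hf1 x hx, mem_union, mem_ofPred_eq, mem_compl_iff]
        simp only [hx', false_or, not_false_eq_true, and_true]
    rw [h1]
    refine (hemb.isClosedMap _ (hC.preimage (by fun_prop))).union ?_
    by_cases h1C : (1 : ℝ) ∈ C
    · simpa only [h1C, true_and, ofPred_mem_eq] using hopen.isClosed_compl
    · simp [h1C]
  · ext x
    rw [mem_preimage, mem_singleton_iff]
    by_cases hx : x ∈ range h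
    · obtain ⟨z, rfl⟩ := hx
      have h2 : h z ∈ B ↔ z.2 = 0 := by rw [← mem_preimage, hpre]; rfl
      rw [hfh, h2]
      exact ⟨fun h => Subtype.ext h, fun h => by rw [h]; rfl⟩
    · rw [hf1 x hx]
      refine ⟨fun h => absurd h one_ne_zero, fun hxB => absurd ⟨(⟨x, hxB⟩, 0), hid ⟨x, hxB⟩⟩ hx⟩

theorem Prufer.denseRange_plane : DenseRange Prufer.plane := by
  rintro (p | ⟨a, x⟩)
  · exact subset_closure ⟨p, rfl⟩
  · refine mem_closure_iff.2 fun O hO hx => ?_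
    rw [← Prufer.chart_halfEdge] at hx
    obtain ⟨ε, hε, h⟩ := HalfPlane.exists_box
      ((hO.preimage (Prufer.continuous_chart a)).mem_nhds hx)
    let z : HalfPlane := (x, ⟨ε / 2, mem_Ici.2 (by positivity)⟩)
    refine ⟨_, h z (sub_lt_self x hε) (lt_add_of_pos_right x hε) (half_lt_self hε), ?_⟩
    rw [Prufer.chart_of_pos a (z := z) (half_pos hε)]
    exact ⟨_, rfl⟩

/-! ### Ford discs and the collar of the boundary -/

/-- The factor by which the unit collar is compressed at the point of slope `t` of `ℝ_q`, so that
its image is the disc of diameter `1 / q.den ^ 2` tangent to the vertical axis at `q`. -/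
noncomputable def fordScale (q : ℚ) (t : ℝ) : ℝ := ((q.den : ℝ) ^ 2 * (1 + t ^ 2))⁻¹

theorem den_sq_pos (q : ℚ) : 0 < (q.den : ℝ) ^ 2 := by
  have := q.den_pos
  positivity

theorem fordScale_pos (q : ℚ) (t : ℝ) : 0 < fordScale q t := by
  have := den_sq_pos q
  unfold fordScale
  positivity

theorem continuous_fordScale (q : ℚ) : Continuous (fordScale q) := by
  refine Continuous.inv₀ (by fun_prop) fun t => ?_
  have := den_sq_pos q
  positivity

/-- The compression of the half plane that maps the unit collar to a disc tangent to the axis. -/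
noncomputable def fordHomeomorph (q : ℚ) : HalfPlane ≃ₜ HalfPlane where
  toFun z := (z.1, ⟨z.2 * fordScale q z.1,
    mem_Ici.2 (mul_nonneg (mem_Ici.1 z.2.2) (fordScale_pos q _).le)⟩)
  invFun z := (z.1, ⟨z.2 / fordScale q z.1,
    mem_Ici.2 (div_nonneg (mem_Ici.1 z.2.2) (fordScale_pos q _).le)⟩)
  left_inv z := Prod.ext rfl (Subtype.ext (mul_div_cancel_right₀ _ (fordScale_pos q _).ne'))
  right_inv z := Prod.ext rfl (Subtype.ext (div_mul_cancel₀ _ (fordScale_pos q _).ne'))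
  continuous_toFun := continuous_fst.prodMk <| Continuous.subtype_mk
    (Continuous.mul (by fun_prop) ((continuous_fordScale q).comp continuous_fst)) _
  continuous_invFun := continuous_fst.prodMk <| Continuous.subtype_mk
    (Continuous.div (by fun_prop) ((continuous_fordScale q).comp continuous_fst)
      fun z => (fordScale_pos q _).ne') _

theorem fordHomeomorph_halfEdge (q : ℚ) (t : ℝ) : fordHomeomorph q (halfEdge t) = halfEdge t :=
  Prod.ext rfl (Subtype.ext (zero_mul _))

/-- Over the common denominator `q.den * r.den`, the difference has a nonzero integer numerator. -/
theorem sq_sub_rat_ge {q r : ℚ} (h : q ≠ r) :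
    (((q.den : ℝ) ^ 2)⁻¹ * ((r.den : ℝ) ^ 2)⁻¹) ≤ ((q : ℝ) - r) ^ 2 := by
  have hq := den_sq_pos q
  have hr := den_sq_pos r
  have hq0 : (q.den : ℝ) ≠ 0 := Nat.cast_ne_zero.2 q.den_nz
  have hr0 : (r.den : ℝ) ≠ 0 := Nat.cast_ne_zero.2 r.den_nz
  have hn : q.num * r.den - r.num * q.den ≠ 0 := fun h0 => h <| by
    rw [Rat.eq_iff_mul_eq_mul]
    exact sub_eq_zero.1 h0
  have h1 : (1 : ℝ) ≤ ((q.num : ℝ) * r.den - r.num * q.den) ^ 2 := by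
    have : (1 : ℤ) ≤ (q.num * r.den - r.num * q.den) ^ 2 := by
      have := sq_pos_of_ne_zero hn
      omega
    exact_mod_cast this
  have h2 : (q : ℝ) - r = (q.num * r.den - r.num * q.den) / (q.den * r.den) := by
    rw [Rat.cast_def q, Rat.cast_def r]
    field_simp
  rw [h2, div_pow, mul_pow, ← mul_inv, ← one_div]
  gcongr

/-- The open discs of diameters `d` and `e` tangent to the vertical axis at heights whose distance
is at least the geometric mean of `d` and `e` are disjoint. -/
theorem tangent_discs_disjoint {s A B d e : ℝ} (hs : 0 < s) (hA : s ^ 2 + A ^ 2 < d * s)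
    (hB : s ^ 2 + B ^ 2 < e * s) : (A - B) ^ 2 < d * e := by
  have hd : 0 < d - s := by nlinarith [sq_nonneg A]
  have he : 0 < e - s := by nlinarith [sq_nonneg B]
  have h1 : A ^ 2 ≤ s * (d - s) := by linarith
  have h2 : B ^ 2 ≤ s * (e - s) := by linarith
  have h3 : A ^ 2 * B ^ 2 ≤ s * (d - s) * (s * (e - s)) := by gcongr
  -- The inequality of arithmetic and geometric means. Added to the strict bounds on `A ^ 2` and `B
  -- ^ 2`, it gives exactly `d * e`.
  have h4 : |2 * A * B| ≤ (d - s) * (e - s) + s ^ 2 := by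
    refine abs_le_of_sq_le_sq ?_ (by positivity)
    nlinarith [sq_nonneg ((d - s) * (e - s) - s ^ 2)]
  nlinarith [neg_abs_le (2 * A * B)]

/-- The half-open unit interval, as a subset of the half line. -/
abbrev UnitIco : Type := {s : Ici (0 : ℝ) // (s : ℝ) < 1}

namespace MoorePrufer

open Prufer

instance (D : Set ℝ) : TopologicalSpace.SeparableSpace (MoorePrufer D) :=
  ((proj_surjective D).denseRange.comp denseRange_plane (continuous_proj D)).separableSpace
    (isOpenEmbedding_plane D).continuous

theorem rat_notMem_irrational (q : ℚ) : (q : ℝ) ∉ {a : ℝ | Irrational a} := fun h => h ⟨q, rfl⟩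

theorem sq_add_sq_lt_of_fordHomeomorph {q : ℚ} {z : HalfPlane} (hz : (z.2 : ℝ) < 1) {s y : ℝ}
    (hs : 0 < s) {hs' : 0 < (s, y).1} (h : chart q (fordHomeomorph q z) = plane ⟨(s, y), hs'⟩) :
    s ^ 2 + (y - q) ^ 2 < ((q.den : ℝ) ^ 2)⁻¹ * s := by
  have hd := den_sq_pos q
  rw [← chart_coord q] at h
  have h1 := chart_injective _ h
  have h2 : z.1 = (y - q) / s := congrArg Prod.fst h1
  have h3 : (z.2 : ℝ) * fordScale q z.1 = s := congrArg (fun z : HalfPlane => (z.2 : ℝ)) h1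
  have h4 : s < fordScale q z.1 := by
    rw [← h3]
    exact mul_lt_of_lt_one_left (fordScale_pos q _) hz
  rw [fordScale, h2, mul_inv, ← div_eq_mul_inv, lt_div_iff₀ (by positivity)] at h4
  calc s ^ 2 + (y - q) ^ 2 = s * (1 + ((y - q) / s) ^ 2) * s := by field_simp
    _ < _ := by gcongr

/-- The union of the collars of the components at rational heights. -/
noncomputable def fordCollar (x : (Σ _ : ℚ, ℝ) × UnitIco) : MoorePrufer {a | Irrational a} :=
  proj _ (chart x.1.1 (fordHomeomorph x.1.1 (x.1.2, x.2)))

/-- Over one height the chart is injective. A common point over different heights would lie in two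
Ford discs, or be an edge point of two components. -/
theorem fordCollar_injective : Function.Injective fordCollar := by
  rintro ⟨⟨q, t⟩, s⟩ ⟨⟨r, t'⟩, s'⟩ h
  simp only [fordCollar] at h
  by_cases hqr : q = r
  · subst hqr
    have h1 := (isOpenEmbedding_chart (rat_notMem_irrational q)).injective h
    have h2 := (fordHomeomorph q).injective h1
    rw [Prod.mk.injEq] at h2
    rw [h2.1, Subtype.ext h2.2]
  · exfalso
    rcases proj_eq_iff.1 h with h | ⟨a, ha, x, h, -⟩
    · rcases hp : chart q (fordHomeomorph q (t, s)) with ⟨⟨σ, y⟩, hσ⟩ | ⟨a, x⟩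
      · rw [hp] at h
        have h1 := sq_add_sq_lt_of_fordHomeomorph s.2 hσ hp
        have h2 := sq_add_sq_lt_of_fordHomeomorph s'.2 hσ h.symm
        have h3 := tangent_discs_disjoint hσ h1 h2
        have h4 := sq_sub_rat_ge hqr
        nlinarith
      · have h1 : edge a x ∈ chart q '' univ := ⟨_, mem_univ _, hp⟩
        have h2 : edge a x ∈ chart r '' univ := ⟨_, mem_univ _, h.symm.trans hp⟩
        exact hqr (Rat.cast_injective (α := ℝ)
          ((edge_mem_image_chart.1 h1).1.symm.trans (edge_mem_image_chart.1 h2).1))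
    · have h1 : edge a x ∈ chart q '' univ := ⟨_, mem_univ _, h⟩
      exact rat_notMem_irrational q ((edge_mem_image_chart.1 h1).1 ▸ ha)

theorem isOpenEmbedding_fordCollar : IsOpenEmbedding fordCollar := by
  let f : (Σ _ : ℚ, ℝ × UnitIco) → MoorePrufer {a | Irrational a} := fun x =>
    proj _ (chart x.1 (fordHomeomorph x.1 (x.2.1, x.2.2)))
  have hopen : IsOpen {s : Ici (0 : ℝ) | (s : ℝ) < 1} :=
    isOpen_lt (by fun_prop) continuous_const
  have hf : ∀ q, IsOpenEmbedding fun z : ℝ × UnitIco => f ⟨q, z⟩ := fun q =>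
    (isOpenEmbedding_chart (rat_notMem_irrational q)).comp
      ((fordHomeomorph q).isOpenEmbedding.comp
        (IsOpenEmbedding.id.prodMap hopen.isOpenEmbedding_subtypeVal))
  have heq : fordCollar = f ∘ Homeomorph.sigmaProdDistrib := rfl
  refine .of_continuous_injective_isOpenMap ?_ fordCollar_injective ?_
  · rw [heq]
    exact (continuous_sigma fun q => (hf q).continuous).comp (Homeomorph.continuous _)
  · rw [heq]
    exact (isOpenMap_sigma.2 fun q => (hf q).isOpenMap).comp (Homeomorph.isOpenMap _)

/-- The origin of the half-open unit interval. -/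
def _root_.UnitIco.zero : UnitIco := ⟨⟨0, mem_Ici.2 le_rfl⟩, zero_lt_one⟩

theorem fordCollar_zero (q : ℚ) (t : ℝ) :
    fordCollar (⟨q, t⟩, UnitIco.zero) = proj _ (edge q t) := by
  have : fordHomeomorph q (t, UnitIco.zero) = halfEdge t := fordHomeomorph_halfEdge q t
  simp only [fordCollar, this, chart_halfEdge]

theorem mem_surfaceBoundary_irrational_iff {y : MoorePrufer {a | Irrational a}} :
    y ∈ surfaceBoundary (MoorePrufer {a | Irrational a}) ↔
      ∃ (q : ℚ) (x : ℝ), proj _ (edge q x) = y := by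
  rw [mem_surfaceBoundary_iff]
  constructor
  · rintro ⟨a, ha, x, rfl⟩
    obtain ⟨q, rfl⟩ := not_not.1 ha
    exact ⟨q, x, rfl⟩
  · rintro ⟨q, x, rfl⟩
    exact ⟨q, rat_notMem_irrational q, x, rfl⟩

theorem surfaceBoundary_irrational_eq_iUnion :
    surfaceBoundary (MoorePrufer {a | Irrational a}) =
      ⋃ q : ℚ, component {a | Irrational a} (q : ℝ) := by
  ext y
  simp only [mem_surfaceBoundary_irrational_iff, mem_iUnion, component, Prufer.component,
    ← range_comp, mem_range, Function.comp_apply]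

/-- The boundary of the surface Moorised at the irrational heights is a sum of lines. -/
theorem exists_homeomorph_surfaceBoundary :
    ∃ ψ : (Σ _ : ℚ, ℝ) ≃ₜ surfaceBoundary (MoorePrufer {a | Irrational a}),
      ∀ x, (ψ x : MoorePrufer {a | Irrational a}) = fordCollar (x, UnitIco.zero) := by
  have he : IsEmbedding fun x : (Σ _ : ℚ, ℝ) => fordCollar (x, UnitIco.zero) :=
    isOpenEmbedding_fordCollar.isEmbedding.comp (isEmbedding_prodMkLeft UnitIco.zero)
  have hr : range (fun x : (Σ _ : ℚ, ℝ) => fordCollar (x, UnitIco.zero)) =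
      surfaceBoundary (MoorePrufer {a | Irrational a}) := by
    ext y
    simp only [mem_surfaceBoundary_irrational_iff, mem_range, Sigma.exists, fordCollar_zero]
  exact ⟨he.toHomeomorph.trans (Homeomorph.setCongr hr), fun x => rfl⟩

theorem metrizableSpace_surfaceBoundary :
    TopologicalSpace.MetrizableSpace (surfaceBoundary (MoorePrufer {a | Irrational a})) := by
  obtain ⟨ψ, -⟩ := exists_homeomorph_surfaceBoundary
  exact ψ.symm.isEmbedding.metrizableSpace

/-- The embedding of the unit interval onto the first half of the half-open unit interval. -/
noncomputable def halve (s : unitInterval) : UnitIco :=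
  ⟨⟨s / 2, mem_Ici.2 (by linarith [s.2.1])⟩, by simp only; linarith [s.2.2]⟩

theorem isEmbedding_halve : IsEmbedding halve := by
  refine (Continuous.isClosedEmbedding ?_ fun s s' h => ?_).isEmbedding
  · exact Continuous.subtype_mk (Continuous.subtype_mk (by fun_prop) _) _
  · have h1 : (s : ℝ) / 2 = s' / 2 := congrArg (fun s : UnitIco => (s : ℝ)) h
    exact Subtype.ext (by linarith)

theorem halve_zero : halve 0 = UnitIco.zero := Subtype.ext (Subtype.ext (zero_div 2))

theorem isCollared_surfaceBoundary :
    IsCollared (surfaceBoundary (MoorePrufer {a | Irrational a})) := by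
  obtain ⟨ψ, hψ⟩ := exists_homeomorph_surfaceBoundary
  have hid : ∀ x, fordCollar (ψ.symm x, halve 0) = x := fun x => by
    rw [halve_zero, ← hψ, ψ.apply_symm_apply]
  -- Closed Ford discs may touch, so disjointness is available only for the half-open collars; the
  -- closed unit interval is therefore squeezed into their first half.
  refine ⟨isClosed_surfaceBoundary, fordCollar ∘ Prod.map ψ.symm halve,
    isOpenEmbedding_fordCollar.isEmbedding.comp (ψ.symm.isEmbedding.prodMap isEmbedding_halve),
    hid, ?_, ?_⟩
  · ext ⟨x, s⟩
    constructor
    · intro h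
      have h1 := hid ⟨_, h⟩
      exact (isEmbedding_halve.injective (congrArg Prod.snd (fordCollar_injective h1))).symm
    · rintro rfl
      have h1 : fordCollar (ψ.symm x, halve 0) ∈ surfaceBoundary _ := (hid x).symm ▸ x.2
      exact h1
  · have : Prod.map ψ.symm halve '' {z | z.2 < 1} =
        (fun z : (Σ _ : ℚ, ℝ) × UnitIco => (z.2 : ℝ)) ⁻¹' Iio (1 / 2) := by
      ext ⟨x, s⟩
      constructor
      · rintro ⟨⟨y, r⟩, hr, h⟩
        have h1 : (r : ℝ) < 1 := hr
        have h2 : (r : ℝ) / 2 = s := congrArg (fun z : (Σ _ : ℚ, ℝ) × UnitIco => (z.2 : ℝ)) h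
        simp only [mem_preimage, mem_Iio]
        linarith
      · intro h
        simp only [mem_preimage, mem_Iio] at h
        have h0 := mem_Ici.1 s.1.2
        refine ⟨(ψ x, ⟨2 * s, by linarith, by linarith⟩), ?_, ?_⟩
        · have h1 : (2 : ℝ) * s < 1 := by linarith
          exact h1
        · refine Prod.ext (ψ.symm_apply_apply x) (Subtype.ext (Subtype.ext ?_))
          simp [halve]
    rw [image_comp, this]
    exact isOpenEmbedding_fordCollar.isOpenMap _ (isOpen_Iio.preimage (by fun_prop))

/-! ### The boundary is not a zero-set -/

theorem not_isMeagre_irrational : ¬ IsMeagre {a : ℝ | Irrational a} :=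
  not_isMeagre_of_mem_residual eventually_residual_irrational

theorem not_isZeroSet_surfaceBoundary :
    ¬ IsZeroSet (surfaceBoundary (MoorePrufer {a | Irrational a})) := by
  rintro ⟨f, hf, hzero⟩
  have hf0 : ∀ y, f y = 0 ↔ ∃ (q : ℚ) (x : ℝ), proj _ (edge q x) = y := fun y => by
    rw [← mem_surfaceBoundary_irrational_iff, ← hzero]
    rfl
  -- `f` has no zero on the components at irrational heights, so countably many lower bounds for
  -- `|f|` cover these heights.
  have hcov : ∃ n : ℕ, ¬ IsMeagre {a : ℝ |
      (component {a | Irrational a} a ∩ {y | 1 / ((n : ℝ) + 1) < |f y|}).Nonempty} := by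
    by_contra! hcon
    refine not_isMeagre_irrational ((isMeagre_iUnion hcon).mono fun a ha => ?_)
    have hne : f (proj _ (edge a 0)) ≠ 0 := fun h => by
      obtain ⟨q, x, h⟩ := (hf0 _).1 h
      rcases proj_eq_iff.1 h with h | ⟨b, hb, y, h, -⟩
      · exact rat_notMem_irrational q ((edge.inj h).1 ▸ ha)
      · exact rat_notMem_irrational q ((edge.inj h).1 ▸ hb)
    obtain ⟨n, hn⟩ := exists_nat_one_div_lt (abs_pos.2 hne)
    exact mem_iUnion.2 ⟨n, _, ⟨_, ⟨0, rfl⟩, rfl⟩, hn⟩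
  obtain ⟨n, hn⟩ := hcov
  have hU : IsOpen {y | 1 / ((n : ℝ) + 1) < |f y|} := isOpen_lt continuous_const hf.abs
  obtain ⟨c, u, v, hc, huv, hstrip⟩ := exists_strip_subset hn hU fun a ha => ha
  obtain ⟨q, hq1, hq2⟩ := exists_rat_btwn huv
  have hV : IsOpen {z : HalfPlane | |f (proj _ (chart q z))| < 1 / ((n : ℝ) + 1)} :=
    isOpen_lt (hf.comp ((continuous_proj _).comp (continuous_chart q))).abs continuous_const
  have hmem : halfEdge 0 ∈ {z : HalfPlane | |f (proj _ (chart q z))| < 1 / ((n : ℝ) + 1)} := by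
    have h0 : f (proj _ (chart q (halfEdge 0))) = 0 := by
      rw [chart_halfEdge]
      exact (hf0 _).2 ⟨q, 0, rfl⟩
    simp only [mem_ofPred_eq, h0, abs_zero]
    positivity
  obtain ⟨ε, hε, hbox⟩ := HalfPlane.exists_box (hV.mem_nhds hmem)
  have hs : 0 < min ε c / 2 := by positivity
  have hsε : min ε c / 2 < ε := by linarith [min_le_left ε c]
  have hsc : min ε c / 2 < c := by linarith [min_le_right ε c]
  -- Slope `0` keeps the point at height `q`, inside the strip; its abscissa is small enough for
  -- both the strip and the neighborhood of `edge q 0` where `|f|` is small.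
  let z : HalfPlane := (0, ⟨min ε c / 2, mem_Ici.2 hs.le⟩)
  have h1 : |f (proj _ (chart q z))| < 1 / ((n : ℝ) + 1) :=
    hbox z (by simp [z, hε]) (by simp [z, hε]) hsε
  refine lt_asymm h1 (hstrip (mem_image_of_mem _ ?_))
  rw [chart_of_pos q (z := z) hs]
  exact mem_image_of_mem _ ⟨hsc, by simpa [z] using hq1, by simpa [z] using hq2⟩

end MoorePrufer

theorem mainTheorem10 :
    -- The Prüfer surface, its boundary, and the strip property of its open sets.
    (IsSurface Prufer ∧
      surfaceBoundary Prufer = ⋃ a : ℝ, Prufer.component a ∧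
      ∀ G : Set ℝ, ¬ IsMeagre G → ∀ U : Set Prufer, IsOpen U →
        (∀ a ∈ G, (Prufer.component a ∩ U).Nonempty) →
        ∃ c u v : ℝ, 0 < c ∧ u < v ∧ Prufer.strip c u v ⊆ U) ∧
    -- The strip property when some of the components are Moorised.
    (∀ D : Set ℝ, ∀ G : Set ℝ, ¬ IsMeagre G → ∀ U : Set (MoorePrufer D), IsOpen U →
        (∀ a ∈ G, (MoorePrufer.component D a ∩ U).Nonempty) →
        ∃ c u v : ℝ, 0 < c ∧ u < v ∧ MoorePrufer.strip D c u v ⊆ U) ∧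
    -- The surface Moorised at the irrational heights.
    (IsSurface (MoorePrufer {a | Irrational a}) ∧
      TopologicalSpace.SeparableSpace (MoorePrufer {a | Irrational a}) ∧
      surfaceBoundary (MoorePrufer {a | Irrational a}) =
        ⋃ q : ℚ, MoorePrufer.component {a | Irrational a} (q : ℝ) ∧
      TopologicalSpace.MetrizableSpace (surfaceBoundary (MoorePrufer {a | Irrational a})) ∧
      IsCollared (surfaceBoundary (MoorePrufer {a | Irrational a})) ∧
      ¬ IsZeroSet (surfaceBoundary (MoorePrufer {a | Irrational a})) ∧
      ¬ IsStronglyCollared (surfaceBoundary (MoorePrufer {a | Irrational a}))) :=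
  ⟨⟨Prufer.isSurface, Prufer.surfaceBoundary_eq,
      fun _ hG _ hU h => Prufer.exists_strip_subset hG hU h⟩,
    fun _ _ hG _ hU h => MoorePrufer.exists_strip_subset hG hU h,
    MoorePrufer.isSurface _, inferInstance, MoorePrufer.surfaceBoundary_irrational_eq_iUnion,
    MoorePrufer.metrizableSpace_surfaceBoundary, MoorePrufer.isCollared_surfaceBoundary,
    MoorePrufer.not_isZeroSet_surfaceBoundary,
    fun h => MoorePrufer.not_isZeroSet_surfaceBoundary h.isZeroSet⟩
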